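/- All graphs are finite and simple, with node set $V=[n]$. A *port* of $G=(V,E)$ is a pair $(v,i)$ with $v\in V$ and $i\in\{1,\dots,\deg(v)\}$. A *consistent port numbering* of $G$ is an involution $p$ of the set of ports such that for every edge $\{u,v\}$ there are $i,j$ with $p(u,i)=(v,j)$. For $i\le\deg(v)$ write $(p_{\mathrm{tail}}(v,i),p_{\mathrm{n}}(v,i))$ for the port $(u,j)$ with $p(u,j)=(v,i)$; for $i>\deg(v)$ both entries are a special symbol $-$. For an integer $\Delta\ge 1$, a *CPNGNN* $N$ with degree features is given by a number $L$ of layers, dimensions $d_1=\Delta+1,d_2,\dots,d_{L+1}$, matrices $W^{(l)}\in\mathbb{R}^{d_{l+1}\times(d_l+\Delta(d_l+1))}$ and a ReLU multilayer perceptron $M:\mathbb{R}^{d_{L+1}}\to\mathbb{R}^{2}$. On a graph $G$ of maximum degree at most $\Delta$ with a consistent port numbering $p$ it sets $z^{(1)}_v$ to be the one-hot encoding of $\deg(v)\in\{0,\dots,\Delta\}$ and computes $$z_v^{(l+1)}=\mathrm{ReLU}\Big(W^{(l)}\,\mathrm{Concat}\big(z_v^{(l)},z^{(l)}_{p_{\mathrm{tail}}(v,1)},p_{\mathrm{n}}(v,1),\dots,z^{(l)}_{p_{\mathrm{tail}}(v,\Delta)},p_{\mathrm{n}}(v,\Delta)\big)\Big),\qquad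 l=1,\dots,L,$$ where $z^{(l)}_-$ and $-$ are encoded by zeros. The output label $N(G,p,v)\in\{0,1\}$ is the (first) index of a maximal entry of $M(z_v^{(L+1)})$. For $\alpha\ge 1$, *CPNGNNs can solve $\alpha$-approximation for the minimum vertex cover problem* if for every integer $\Delta\ge1$ there is a CPNGNN $N$ such that for every graph $G$ of maximum degree at most $\Delta$ and every consistent port numbering $p$ of $G$, the set $\{v\in V: N(G,p,v)=1\}$ is a vertex cover of $G$ with at most $\alpha\cdot\tau(G)$ elements, where $\tau(G)$ is the minimum size of a vertex cover of $G$. **Theorem.** The optimal approximation ratio of CPNGNNs with degree features for the minimum vertex cover problem is $2$: CPNGNNs can solve $2$-approximation for the minimum vertex cover problem, and for any $1\le\alpha<2$, CPNGNNs cannot solve $\alpha$-approximation for the minimum vertex cover problem. -/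

import Mathlib

/-! # Graphs with port numberings -/

/-- `G` has maximum degree at most `Δ`. -/
def HasMaxDegreeAtMost {n : ℕ} (G : SimpleGraph (Fin n)) [DecidableRel G.Adj] (Δ : ℕ) : Prop :=
  ∀ v, G.degree v ≤ Δ

/-- The ports of `G`: pairs `(v, i)` where `v` is a node and `i` is one of `deg v` indices.
The element `i : Fin (deg v)` stands for the port number `i + 1` in `{1, …, deg v}`. -/
abbrev Port {n : ℕ} (G : SimpleGraph (Fin n)) [DecidableRel G.Adj] : Type :=
  (v : Fin n) × Fin (G.degree v)

/-- A consistent port numbering of `G`: an involution `p` of the set of ports such that for every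
edge `{u, v}` some port of `u` is mapped to some port of `v`. -/
structure ConsistentPortNumbering {n : ℕ} (G : SimpleGraph (Fin n)) [DecidableRel G.Adj] where
  /-- the map on ports -/
  p : Port G → Port G
  /-- every edge is realised by a pair of ports -/
  edge : ∀ u v, G.Adj u v →
    ∃ (i : Fin (G.degree u)) (j : Fin (G.degree v)), p ⟨u, i⟩ = ⟨v, j⟩
  /-- consistency -/
  involutive : Function.Involutive p

namespace ConsistentPortNumbering

variable {n : ℕ} {G : SimpleGraph (Fin n)} [DecidableRel G.Adj]

/-- The port from which port `i` of the node `v` receives its messages, i.e. the port `(u, j)` with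
`p (u, j) = (v, i)`; `none` (the special symbol `-`) if `v` has no port `i`.
As `p` is an involution, this port is `p (v, i)`, see `source_eq_some_iff`. -/
def source (P : ConsistentPortNumbering G) (v : Fin n) (i : ℕ) : Option (Port G) :=
  if h : i < G.degree v then some (P.p ⟨v, ⟨i, h⟩⟩) else none

theorem source_eq_some_iff (P : ConsistentPortNumbering G) (v : Fin n) (i : ℕ) (x : Port G) :
    P.source v i = some x ↔ ∃ h : i < G.degree v, P.p x = ⟨v, ⟨i, h⟩⟩ := by
  unfold source
  split_ifs with h
  · simp only [Option.some.injEq]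
    constructor
    · rintro rfl
      exact ⟨h, P.involutive _⟩
    · rintro ⟨_, hx⟩
      rw [← hx, P.involutive x]
  · simp [h]

/-- `p_tail(v, i)`: the node that sends messages to port `i` of `v`, or the special symbol. -/
def tail (P : ConsistentPortNumbering G) (v : Fin n) (i : ℕ) : Option (Fin n) :=
  (P.source v i).map fun x => x.1

/-- `p_n(v, i)`: the number in `{1, …, Δ}` of the port of `p_tail(v, i)` that sends messages to
port `i` of `v`, or the special symbol. -/
def number (P : ConsistentPortNumbering G) (v : Fin n) (i : ℕ) : Option ℕ :=
  (P.source v i).map fun x => (x.2 : ℕ) + 1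

end ConsistentPortNumbering

/-! # Consistent port numbering graph neural networks -/

/-- `ReLU(x) = max(x, 0)`. -/
noncomputable def relu (x : ℝ) : ℝ := max x 0

/-- Index set, with `d + Δ (d + 1)` elements, of the concatenation of the embedding of a node
and of `Δ` pairs (embedding of a neighbour, port number). -/
abbrev ConcatIndex (Δ d : ℕ) : Type := Fin d ⊕ Fin Δ × (Fin d ⊕ Unit)

/-- The vector `Concat(z_v, z_{p_tail(v,1)}, p_n(v,1), …, z_{p_tail(v,Δ)}, p_n(v,Δ))`.
The special symbol is encoded by zeros (proper port numbers are at least `1`). -/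
def concat {n : ℕ} {G : SimpleGraph (Fin n)} [DecidableRel G.Adj]
    (P : ConsistentPortNumbering G) (Δ : ℕ) {d : ℕ} (z : Fin n → Fin d → ℝ) (v : Fin n) :
    ConcatIndex Δ d → ℝ
  | .inl k => z v k
  | .inr (i, .inl k) => ((P.tail v i).map fun u => z u k).getD 0
  | .inr (i, .inr _) => ((P.number v i).getD 0 : ℕ)

/-- The weight matrices of finitely many message passing layers, for degree bound `Δ`, that
transform embeddings of dimension `d` into embeddings of dimension `e`. -/
inductive Layers (Δ : ℕ) : ℕ → ℕ → Type
  /-- no layer -/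
  | nil (d : ℕ) : Layers Δ d d
  /-- a layer with weight matrix `W ∈ ℝ^{d' × (d + Δ (d + 1))}`, followed by further layers -/
  | cons {d d' e : ℕ} (W : Matrix (Fin d') (ConcatIndex Δ d) ℝ) (rest : Layers Δ d' e) :
      Layers Δ d e

/-- Apply the layers one after another; a layer with weight matrix `W` replaces the embeddings
`z` by `ReLU (W Concat(z_v, …))` at all nodes `v` simultaneously. -/
noncomputable def Layers.eval {n : ℕ} {G : SimpleGraph (Fin n)} [DecidableRel G.Adj]
    (P : ConsistentPortNumbering G) {Δ : ℕ} :
    {d e : ℕ} → Layers Δ d e → (Fin n → Fin d → ℝ) → (Fin n → Fin e → ℝ)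
  | _, _, .nil _, z => z
  | _, _, .cons W rest, z =>
      rest.eval P fun v k => relu (W.mulVec (concat P Δ z v) k)

/-- The parameters of a multilayer perceptron with `ReLU` activations, input dimension `d` and
output dimension `e`. -/
inductive MultiLayerPerceptron : ℕ → ℕ → Type
  /-- the affine output layer -/
  | output {d e : ℕ} (W : Matrix (Fin e) (Fin d) ℝ) (b : Fin e → ℝ) : MultiLayerPerceptron d e
  /-- a hidden layer, followed by further layers -/
  | hidden {d h e : ℕ} (W : Matrix (Fin h) (Fin d) ℝ) (b : Fin h → ℝ)
      (rest : MultiLayerPerceptron h e) : MultiLayerPerceptron d e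

/-- The function computed by a multilayer perceptron. -/
noncomputable def MultiLayerPerceptron.eval :
    {d e : ℕ} → MultiLayerPerceptron d e → (Fin d → ℝ) → (Fin e → ℝ)
  | _, _, .output W b, x => fun k => W.mulVec x k + b k
  | _, _, .hidden W b rest, x => rest.eval fun k => relu (W.mulVec x k + b k)

theorem argmax_nonempty {q : ℕ} [NeZero q] (z : Fin q → ℝ) :
    (Finset.univ.filter fun i => ∀ j, z j ≤ z i).Nonempty := by
  obtain ⟨i, hi⟩ := Finite.exists_max z
  exact ⟨i, by simpa using hi⟩

/-- The (first) index of a maximal entry. -/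
noncomputable def argmax {q : ℕ} [NeZero q] (z : Fin q → ℝ) : Fin q :=
  (Finset.univ.filter fun i => ∀ j, z j ≤ z i).min' (argmax_nonempty z)

/-- The input feature of a node: the one-hot encoding of its degree in `{0, …, Δ}`. -/
def degreeFeature {n : ℕ} (G : SimpleGraph (Fin n)) [DecidableRel G.Adj] (Δ : ℕ) (v : Fin n) :
    Fin (Δ + 1) → ℝ :=
  fun k => if (k : ℕ) = G.degree v then 1 else 0

/-- A CPNGNN (architecture and parameters) for graphs of maximum degree at most `Δ` with degree
features and with output labels `Fin q`. -/
structure CPNGNN (Δ q : ℕ) where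
  /-- dimension of the embeddings after the last message passing layer -/
  width : ℕ
  /-- the message passing layers -/
  layers : Layers Δ (Δ + 1) width
  /-- the perceptron that computes the final embeddings -/
  mlp : MultiLayerPerceptron width q

/-- The labels that a CPNGNN outputs on a graph with a consistent port numbering. -/
noncomputable def CPNGNN.run {Δ q : ℕ} [NeZero q] (N : CPNGNN Δ q)
    {n : ℕ} (G : SimpleGraph (Fin n)) [DecidableRel G.Adj] (P : ConsistentPortNumbering G)
    (v : Fin n) : Fin q :=
  argmax (N.mlp.eval (N.layers.eval P (degreeFeature G Δ) v))

/-! # Graph problems -/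

/-- A graph problem with label set `Y`: a set of solutions `V → Y` for every graph with node set
`V = Fin n`. -/
abbrev GraphProblem (Y : Type) : Type := (n : ℕ) → SimpleGraph (Fin n) → Set (Fin n → Y)

/-- CPNGNNs (with degree features) solve the graph problem `S`: for every degree bound there is
a single CPNGNN whose output is a solution for every graph obeying the bound and for every
consistent port numbering of it. -/
def CPNGNNsSolve {q : ℕ} [NeZero q] (S : GraphProblem (Fin q)) : Prop :=
  ∀ Δ : ℕ, 0 < Δ → ∃ N : CPNGNN Δ q,
    ∀ (n : ℕ) (G : SimpleGraph (Fin n)) [DecidableRel G.Adj], HasMaxDegreeAtMost G Δ →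
      ∀ P : ConsistentPortNumbering G, N.run G P ∈ S n G

/-- `α`-approximation for the minimum vertex cover problem: the nodes labelled `1` have to form a
vertex cover of size at most `α` times the minimum size of a vertex cover. -/
def approxMinVertexCover (α : ℝ) : GraphProblem (Fin 2) := fun n G =>
  {f : Fin n → Fin 2 | G.IsVertexCover {v | f v = 1} ∧
    ({v | f v = 1}.ncard : ℝ) ≤ α * (G.vertexCoverNum.toNat : ℝ)}

/-! Upper bound: a CPNGNN simulates any synchronous algorithm with finitely many states and a fixed
list of rounds (`exists_cpngnn_applyRules`), so such an algorithm with ratio 2 suffices. Each phase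
computes a maximal matching in the bipartite double cover of the graph of active nodes, treating the
port pairs (i, j) in turn. Nodes with both copies matched join the cover, nodes with one stay
active, nodes with none retire. If one end of an active edge retires, maximality forces both copies
of the other end to be matched, so no edge is lost. A node that stays active loses an active
neighbour, namely the partner of its matched copy, so after Δ phases no edge between active nodes is
left (`CoverInvariant`). The ratio comes from duality (`IsLoad`). Give each arc matched in phase k,
counted from 0, the weight 2^-(k+1). A node matched once in every earlier phase has load 1 - 2^-k,
and two more arcs bring it to exactly 1. So loads are at most 1, and are 1 on the cover. Each arc
has two ends, at least one of them in a given vertex cover C, hence |cover| ≤ total load ≤ 2 · load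
of C ≤ 2|C|. Lower bound: on a single edge both nodes have the same view, so both are chosen, while
one suffices. -/

/-! # Simulation of synchronous algorithms -/

namespace Layers

/-- Concatenation of two stacks of layers. -/
def append {Δ : ℕ} : {a b c : ℕ} → Layers Δ a b → Layers Δ b c → Layers Δ a c
  | _, _, _, .nil _, M => M
  | _, _, _, .cons W rest, M => .cons W (rest.append M)

theorem eval_append {n : ℕ} {G : SimpleGraph (Fin n)} [DecidableRel G.Adj]
    (P : ConsistentPortNumbering G) {Δ : ℕ} {a b c : ℕ} (L : Layers Δ a b) (M : Layers Δ b c)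
    (z : Fin n → Fin a → ℝ) : (L.append M).eval P z = M.eval P (L.eval P z) := by
  induction L with
  | nil d => rfl
  | cons W rest ih => simp only [append, eval, ih]

end Layers

/-- Every function on `{0, …, S}` is a linear combination of shifted rectifiers. -/
theorem exists_relu_interpolation (g : ℕ → ℝ) (S : ℕ) :
    ∃ a : ℕ → ℝ, ∀ s ≤ S, ∑ c ∈ Finset.range (S + 1), a c * relu (s + 1 - c) = g s := by
  induction S with
  | zero => exact ⟨fun _ => g 0, fun s hs => by obtain rfl : s = 0 := by omega
                                                simp [relu]⟩
  | succ S ih =>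
    obtain ⟨a, ha⟩ := ih
    -- The system is triangular with unit diagonal: the new rectifier vanishes on s ≤ S and equals 1
    -- at S + 1, so its coefficient is the error left there.
    refine ⟨Function.update a (S + 1)
      (g (S + 1) - ∑ c ∈ Finset.range (S + 1), a c * relu ((S + 1 : ℕ) + 1 - c)), fun s hs => ?_⟩
    have hlow : ∀ t : ℕ, ∀ b : ℝ, ∑ c ∈ Finset.range (S + 1),
        Function.update a (S + 1) b c * relu (t + 1 - c)
          = ∑ c ∈ Finset.range (S + 1), a c * relu (t + 1 - c) := fun t b =>
      Finset.sum_congr rfl fun c hc => by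
        rw [Function.update_of_ne (by simp at hc; omega)]
    rw [Finset.sum_range_succ, hlow, Function.update_self]
    rcases Nat.lt_or_ge S s with h | h
    · obtain rfl : s = S + 1 := by omega
      have : relu (((S + 1 : ℕ) : ℝ) + 1 - (S + 1 : ℕ)) = 1 := by simp [relu]
      rw [this]; ring
    · have : relu ((s : ℝ) + 1 - (S + 1 : ℕ)) = 0 := by
        have : (s : ℝ) ≤ S := by exact_mod_cast h
        rw [relu, max_eq_right]; push_cast; linarith
      rw [this, mul_zero, add_zero, ha s h]

/-- Two layers compute any nonnegative function of the concatenated messages, when these are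
vectors of natural numbers below `m` and the entries of each embedding sum to `1`. -/
theorem exists_layers_of_natural_messages {Δ d e m : ℕ}
    (g : (ConcatIndex Δ d → Fin m) → Fin e → ℝ) (hg : ∀ f k, 0 ≤ g f k) :
    ∃ L : Layers Δ d e, ∀ (n : ℕ) (G : SimpleGraph (Fin n)) [DecidableRel G.Adj]
      (P : ConsistentPortNumbering G) (z : Fin n → Fin d → ℝ), (∀ v, ∑ k, z v k = 1) →
      ∀ f : Fin n → ConcatIndex Δ d → Fin m, (∀ v k, concat P Δ z v k = (f v k : ℕ)) →
        L.eval P z = fun v => g (f v) := by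
  classical
  let N := Fintype.card (ConcatIndex Δ d)
  let idx : ConcatIndex Δ d ≃ Fin N := Fintype.equivFin _
  let S := m ^ N
  -- A message vector is coded by one number with base-m digits, hence below m ^ N; the default 0 is
  -- never used on a code.
  let dec : ℕ → Fin e → ℝ := fun s k =>
    if h : s < m ^ N then g (fun c => finFunctionFinEquiv.symm ⟨s, h⟩ (idx c)) k else 0
  choose a ha using fun k => exists_relu_interpolation (fun s => dec s k) S
  -- Layers have no bias. The constant 1 - c is obtained by weighting the node's own embedding,
  -- whose entries sum to 1.
  let W₁ : Matrix (Fin (S + 1)) (ConcatIndex Δ d) ℝ := fun c k =>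
    (m : ℝ) ^ (idx k : ℕ) + (Sum.elim (fun _ => 1 - (c : ℝ)) (fun _ => 0) k)
  let W₂ : Matrix (Fin e) (ConcatIndex Δ (S + 1)) ℝ := fun k =>
    Sum.elim (fun c => a k c) (fun _ => 0)
  refine ⟨.cons W₁ (.cons W₂ (.nil e)), fun n G _ P z hz f hf => ?_⟩
  have hcode : ∀ v c, relu (W₁.mulVec (concat P Δ z v) c)
      = relu ((finFunctionFinEquiv (fun k => f v (idx.symm k)) : ℕ) + 1 - c) := fun v c => by
    congr 1
    have h1 : ∑ k, (m : ℝ) ^ (idx k : ℕ) * concat P Δ z v k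
        = (finFunctionFinEquiv (fun k => f v (idx.symm k)) : ℕ) := by
      rw [finFunctionFinEquiv_apply, ← idx.sum_comp]
      push_cast
      exact Finset.sum_congr rfl fun k _ => by rw [hf, idx.symm_apply_apply, mul_comm]
    have h2 : ∑ k, Sum.elim (fun _ => 1 - (c : ℝ)) (fun _ => 0) k * concat P Δ z v k
        = 1 - c := by
      rw [Fintype.sum_sum_type]
      simp [concat, ← Finset.mul_sum, hz]
    simp only [W₁, Matrix.mulVec, dotProduct, add_mul, Finset.sum_add_distrib, h1, h2]
    ring
  funext v k
  simp only [Layers.eval]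
  have hsum : W₂.mulVec (concat P Δ (fun v c => relu (W₁.mulVec (concat P Δ z v) c)) v) k
      = g (f v) k := by
    have hdec : dec (finFunctionFinEquiv (fun k => f v (idx.symm k)) : ℕ) k = g (f v) k := by
      simp only [dec]
      rw [dif_pos (Fin.is_lt _), Fin.eta, Equiv.symm_apply_apply]
      simp
    rw [← hdec, ← ha k _ (Fin.is_lt _).le, ← Fin.sum_univ_eq_sum_range
      (fun c => a k c * relu ((finFunctionFinEquiv (fun k => f v (idx.symm k)) : ℕ) + 1 - c))]
    rw [Matrix.mulVec, dotProduct, Fintype.sum_sum_type]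
    simp only [W₂, Sum.elim_inl, Sum.elim_inr, zero_mul, Finset.sum_const_zero, add_zero]
    exact Finset.sum_congr rfl fun c _ => by rw [← hcode]; rfl
  -- The outer rectifier is harmless because g is nonnegative.
  rw [hsum, relu, max_eq_left (hg _ _)]

/-! # Synchronous message passing on finite state sets -/

/-- What the ports of `v` receive in one communication round when the nodes have states `x`: the
state of the sender and the (zero-based) number of its port. -/
def received {n : ℕ} {G : SimpleGraph (Fin n)} [DecidableRel G.Adj]
    (P : ConsistentPortNumbering G) (Δ : ℕ) {X : Type} (x : Fin n → X) (v : Fin n) (i : Fin Δ) :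
    Option (X × ℕ) :=
  (P.source v i).map fun q => (x q.1, (q.2 : ℕ))

/-- A rule for one communication round: the new state as a function of the old one and of the
received messages. -/
abbrev Rule (Δ : ℕ) (X Y : Type) : Type := X → (Fin Δ → Option (X × ℕ)) → Y

/-- Apply a rule at all nodes simultaneously. -/
def Rule.apply {n : ℕ} {G : SimpleGraph (Fin n)} [DecidableRel G.Adj]
    (P : ConsistentPortNumbering G) {Δ : ℕ} {X Y : Type} (F : Rule Δ X Y) (x : Fin n → X) :
    Fin n → Y :=
  fun v => F (x v) (received P Δ x v)

/-- The one-hot encoding of the elements of a finite type. -/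
def oneHot {X : Type} {d : ℕ} (e : X ≃ Fin d) (a : X) : Fin d → ℝ :=
  fun k => if k = e a then 1 else 0

theorem oneHot_injective {X : Type} {d : ℕ} (e : X ≃ Fin d) : Function.Injective (oneHot e) := by
  intro a b h
  have := congrFun h (e a)
  by_contra hab
  simp [oneHot, hab] at this

theorem sum_oneHot {X : Type} {d : ℕ} (e : X ≃ Fin d) (a : X) : ∑ k, oneHot e a k = 1 := by
  simp [oneHot]

/-- The vector that encodes a state and received messages. -/
def encodeMessages {Δ d : ℕ} {X : Type} (e : X ≃ Fin d) (t : X × (Fin Δ → Option (X × ℕ))) :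
    ConcatIndex Δ d → ℝ
  | .inl k => oneHot e t.1 k
  | .inr (i, .inl k) => ((t.2 i).map fun q => oneHot e q.1 k).getD 0
  | .inr (i, .inr _) => (((t.2 i).map fun q => q.2 + 1).getD 0 : ℕ)

theorem encodeMessages_injective {Δ d : ℕ} {X : Type} (e : X ≃ Fin d) :
    Function.Injective (encodeMessages (Δ := Δ) e) := by
  rintro ⟨a, r⟩ ⟨b, s⟩ h
  have hab : a = b := oneHot_injective e (funext fun k => congrFun h (.inl k))
  have hrs : r = s := by
    funext i
    -- Transmitted port numbers are shifted to be at least 1, so this entry alone tells a missing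
    -- message from a present one.
    have hn := congrFun h (.inr (i, .inr ()))
    have hk := fun k => congrFun h (.inr (i, .inl k))
    simp only [encodeMessages, Nat.cast_inj] at hn hk
    rcases hr : r i with _ | ⟨c, p⟩ <;> rcases hs : s i with _ | ⟨c', p'⟩ <;>
      simp [hr, hs] at hn hk ⊢
    exact ⟨oneHot_injective e (funext hk), hn⟩
  rw [hab, hrs]

theorem concat_oneHot {n : ℕ} {G : SimpleGraph (Fin n)} [DecidableRel G.Adj]
    (P : ConsistentPortNumbering G) {Δ d : ℕ} {X : Type} (e : X ≃ Fin d) (x : Fin n → X)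
    (v : Fin n) :
    concat P Δ (fun u => oneHot e (x u)) v = encodeMessages e (x v, received P Δ x v) := by
  funext k
  rcases k with k | ⟨i, k | _⟩
  · rfl
  · simp [concat, encodeMessages, received, ConsistentPortNumbering.tail, Function.comp_def]
  · simp [concat, encodeMessages, received, ConsistentPortNumbering.number, Function.comp_def]

/-- Every rule on finite state sets is computed by message passing layers. -/
theorem Rule.exists_layers {Δ d d' : ℕ} {X Y : Type} (e : X ≃ Fin d) (e' : Y ≃ Fin d')
    (F : Rule Δ X Y) :
    ∃ L : Layers Δ d d', ∀ (n : ℕ) (G : SimpleGraph (Fin n)) [DecidableRel G.Adj],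
      HasMaxDegreeAtMost G Δ → ∀ (P : ConsistentPortNumbering G) (x : Fin n → X),
        L.eval P (fun v => oneHot e (x v)) = fun v => oneHot e' (F.apply P x v) := by
  classical
  rcases isEmpty_or_nonempty X with hX | hX
  · obtain ⟨L, -⟩ := exists_layers_of_natural_messages (Δ := Δ) (d := d) (e := d') (m := 0)
      (fun _ _ => 0) (fun _ _ => le_rfl)
    exact ⟨L, fun n G _ _ P x => funext fun v => (hX.false (x v)).elim⟩
  -- The entries are bits or port numbers at most Δ; the base Δ + 2 leaves room for the bit 1 even
  -- if Δ = 0.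
  obtain ⟨L, hL⟩ := exists_layers_of_natural_messages (Δ := Δ) (d := d) (e := d') (m := Δ + 2)
    (fun f => oneHot e' (Function.uncurry F
      (Function.invFun (encodeMessages e) fun k => ((f k : ℕ) : ℝ))))
    (fun f k => by unfold oneHot; split_ifs <;> norm_num)
  refine ⟨L, fun n G _ hG P x => ?_⟩
  have hnat : ∀ v k, ∃ c : Fin (Δ + 2),
      concat P Δ (fun u => oneHot e (x u)) v k = (c : ℕ) := by
    have hbit : ∀ a k, ∃ c : Fin (Δ + 2), oneHot e a k = (c : ℕ) := fun a k => by
      unfold oneHot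
      split_ifs
      · exact ⟨1, by simp⟩
      · exact ⟨0, by simp⟩
    rintro v (k | ⟨i, k | _⟩)
    · exact hbit _ _
    · simp only [concat]
      cases P.tail v i with
      | none => exact ⟨0, by simp⟩
      | some u => exact hbit _ _
    · simp only [concat, ConsistentPortNumbering.number]
      cases P.source v i with
      | none => exact ⟨0, by simp⟩
      | some q => exact ⟨⟨q.2 + 1, by have := hG q.1; have := q.2.2; omega⟩, by simp⟩
  choose f hf using hnat
  rw [hL n G P _ (fun v => sum_oneHot e _) f hf]
  funext v
  simp only [← hf, concat_oneHot, Function.leftInverse_invFun (encodeMessages_injective e) _]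
  rfl

/-- Apply the rules of a list one after another. -/
def applyRules {n : ℕ} {G : SimpleGraph (Fin n)} [DecidableRel G.Adj]
    (P : ConsistentPortNumbering G) {Δ : ℕ} {X : Type} (Fs : List (Rule Δ X X)) (x : Fin n → X) :
    Fin n → X :=
  Fs.foldl (fun y F => F.apply P y) x

theorem exists_layers_applyRules {Δ d : ℕ} {X : Type} (e : X ≃ Fin d) (Fs : List (Rule Δ X X)) :
    ∃ L : Layers Δ d d, ∀ (n : ℕ) (G : SimpleGraph (Fin n)) [DecidableRel G.Adj],
      HasMaxDegreeAtMost G Δ → ∀ (P : ConsistentPortNumbering G) (x : Fin n → X),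
        L.eval P (fun v => oneHot e (x v)) = fun v => oneHot e (applyRules P Fs x v) := by
  induction Fs with
  | nil => exact ⟨.nil d, fun n G _ _ P x => rfl⟩
  | cons F Fs ih =>
    obtain ⟨L, hL⟩ := ih
    obtain ⟨M, hM⟩ := F.exists_layers e e
    refine ⟨M.append L, fun n G _ hG P x => ?_⟩
    rw [Layers.eval_append, hM n G hG, hL n G hG]
    rfl

theorem argmax_eq_one_iff (z : Fin 2 → ℝ) (h : z 0 ≠ z 1) : argmax z = 1 ↔ z 0 < z 1 := by
  have hmem := Finset.min'_mem _ (argmax_nonempty z)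
  rw [Finset.mem_filter] at hmem
  have h0 := hmem.2 0
  have h1 := hmem.2 1
  change z 0 ≤ z (argmax z) at h0
  change z 1 ≤ z (argmax z) at h1
  generalize argmax z = i at h0 h1
  fin_cases i
  · simpa using h1
  · simpa using lt_of_le_of_ne h0 h

/-- A synchronous algorithm with finitely many states, whose output is a predicate of the final
state, is computed by a CPNGNN. -/
theorem exists_cpngnn_applyRules {Δ : ℕ} {X : Type} [Finite X] (init : X)
    (Fs : List (Rule Δ X X)) (out : X → Bool) :
    ∃ N : CPNGNN Δ 2, ∀ (n : ℕ) (G : SimpleGraph (Fin n)) [DecidableRel G.Adj],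
      HasMaxDegreeAtMost G Δ → ∀ (P : ConsistentPortNumbering G) (v : Fin n),
        N.run G P v = 1 ↔ out (applyRules P Fs (fun _ => init) v) = true := by
  obtain ⟨d, ⟨e⟩⟩ := Finite.exists_equiv_fin X
  -- The first rule discards the degree feature and puts every node into the state `init`.
  obtain ⟨L₀, hL₀⟩ := Rule.exists_layers (Equiv.refl (Fin (Δ + 1))) e
    (fun _ _ => init : Rule Δ (Fin (Δ + 1)) X)
  obtain ⟨L, hL⟩ := exists_layers_applyRules e Fs
  -- On a one-hot state the output layer gives 1 at the desired label and 0 at the other, so there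
  -- is no tie.
  refine ⟨⟨d, L₀.append L, .output (fun r k => if (r = 1 ↔ out (e.symm k) = true) then 1 else 0)
    (fun _ => 0)⟩, fun n G _ hG P v => ?_⟩
  have hdeg : degreeFeature G Δ = fun v => oneHot (Equiv.refl (Fin (Δ + 1)))
      (⟨G.degree v, Nat.lt_succ_of_le (hG v)⟩ : Fin (Δ + 1)) := by
    funext v k
    simp [degreeFeature, oneHot, Fin.ext_iff]
  have heval := hL₀ n G hG P (fun v => ⟨G.degree v, Nat.lt_succ_of_le (hG v)⟩)
  rw [← hdeg] at heval
  have hinit : (fun v => oneHot e (Rule.apply P (fun _ _ => init : Rule Δ (Fin (Δ + 1)) X)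
      (fun v => (⟨G.degree v, Nat.lt_succ_of_le (hG v)⟩ : Fin (Δ + 1))) v))
      = fun _ : Fin n => oneHot e init := rfl
  simp only [CPNGNN.run, Layers.eval_append, heval, hinit, hL n G hG P,
    MultiLayerPerceptron.eval]
  have hz : ∀ r : Fin 2, Matrix.mulVec (fun r k => if (r = 1 ↔ out (e.symm k) = true) then
      (1 : ℝ) else 0 : Matrix (Fin 2) (Fin d) ℝ)
        (oneHot e (applyRules P Fs (fun _ => init) v)) r + 0
      = if (r = 1 ↔ out (applyRules P Fs (fun _ => init) v) = true) then 1 else 0 := fun r => by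
    simp [Matrix.mulVec, dotProduct, oneHot]
  simp only [hz]
  rw [argmax_eq_one_iff] <;>
    cases out (applyRules P Fs (fun _ => init) v) <;> simp

/-! ### Links between ports -/

namespace ConsistentPortNumbering

variable {n : ℕ} {G : SimpleGraph (Fin n)} [DecidableRel G.Adj]

/-- The ports of a node are used for its edges only. -/
theorem adj_p (P : ConsistentPortNumbering G) (q : Port G) : G.Adj q.1 (P.p q).1 := by
  obtain ⟨u, i⟩ := q
  -- Distinct neighbours of u use distinct ports of u, and u has exactly as many ports as
  -- neighbours; so every port belongs to a neighbour.
  choose f g hfg using fun w : {w // w ∈ G.neighborFinset u} =>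
    P.edge u w ((G.mem_neighborFinset u w).1 w.2)
  have hinj : Function.Injective f := fun w w' h => by
    have h₁ := hfg w
    rw [h, hfg w'] at h₁
    exact Subtype.ext (congrArg Sigma.fst h₁).symm
  obtain ⟨w, rfl⟩ := ((Fintype.bijective_iff_injective_and_card f).2 ⟨hinj, by
    rw [Fintype.card_coe, G.card_neighborFinset_eq_degree, Fintype.card_fin]⟩).2 i
  rw [hfg w]
  exact (G.mem_neighborFinset u w).1 w.2

/-- Port `i` of `u` and port `j` of `v` are connected. -/
def Linked (P : ConsistentPortNumbering G) (i j : ℕ) (u v : Fin n) : Prop :=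
  ∃ (hi : i < G.degree u) (hj : j < G.degree v), P.p ⟨u, ⟨i, hi⟩⟩ = ⟨v, ⟨j, hj⟩⟩

theorem Linked.symm {P : ConsistentPortNumbering G} {i j : ℕ} {u v : Fin n}
    (h : P.Linked i j u v) : P.Linked j i v u := by
  obtain ⟨hi, hj, h⟩ := h
  exact ⟨hj, hi, by rw [← h, P.involutive]⟩

theorem Linked.adj {P : ConsistentPortNumbering G} {i j : ℕ} {u v : Fin n}
    (h : P.Linked i j u v) : G.Adj u v := by
  obtain ⟨hi, hj, h⟩ := h
  have := P.adj_p ⟨u, ⟨i, hi⟩⟩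
  rwa [h] at this

/-- With `left_unique`, this makes the links of a fixed pair (i, j) a partial matching, so all of
them can be added in one round without conflict. -/
theorem Linked.right_unique {P : ConsistentPortNumbering G} {i j : ℕ} {u v w : Fin n}
    (h : P.Linked i j u v) (h' : P.Linked i j u w) : v = w := by
  obtain ⟨hi, hj, h⟩ := h
  obtain ⟨hi', hj', h'⟩ := h'
  exact congrArg Sigma.fst (h.symm.trans h')

theorem Linked.left_unique {P : ConsistentPortNumbering G} {i j : ℕ} {u v w : Fin n}
    (h : P.Linked i j u w) (h' : P.Linked i j v w) : u = v :=
  h.symm.right_unique h'.symm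

theorem exists_linked (P : ConsistentPortNumbering G) {Δ : ℕ} (hG : HasMaxDegreeAtMost G Δ)
    {u v : Fin n} (h : G.Adj u v) : ∃ i j : Fin Δ, P.Linked i j u v := by
  obtain ⟨i, j, hij⟩ := P.edge u v h
  exact ⟨⟨i, i.2.trans_le (hG u)⟩, ⟨j, j.2.trans_le (hG v)⟩, i.2, j.2, hij⟩

theorem received_eq_some_iff (P : ConsistentPortNumbering G) {Δ : ℕ} {X : Type} (x : Fin n → X)
    (u : Fin n) (i : Fin Δ) (t : X) (j : ℕ) :
    received P Δ x u i = some (t, j) ↔ ∃ v, P.Linked i j u v ∧ x v = t := by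
  unfold received source Linked
  constructor
  · intro h
    split_ifs at h with hi
    · simp only [Option.map_some, Option.some.injEq, Prod.mk.injEq] at h
      exact ⟨_, ⟨hi, h.2 ▸ (P.p ⟨u, ⟨i, hi⟩⟩).2.2, by
        refine Sigma.ext rfl (heq_of_eq (Fin.ext h.2))⟩, h.1⟩
    · simp at h
  · rintro ⟨v, ⟨hi, hj, h⟩, rfl⟩
    simp [hi, h]

end ConsistentPortNumbering

/-! # The algorithm -/

/-- The states of the vertex cover algorithm: is the node active, is its out-copy (in-copy)
matched in the bipartite double cover of the graph of active nodes, is it in the cover. -/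
structure NodeState where
  /-- the node is active -/
  act : Bool
  /-- the out-copy is matched -/
  out : Bool
  /-- the in-copy is matched -/
  inc : Bool
  /-- the node is in the cover -/
  cov : Bool

instance : Finite NodeState :=
  Finite.of_injective (fun s : NodeState => (s.act, s.out, s.inc, s.cov)) fun s t h => by
    cases s; cases t; simpa using h

/-- All edges that leave through port `i` and enter through port `j`, and whose end copies are
active and unmatched, are added to the matching. -/
def matchRule {Δ : ℕ} (i j : Fin Δ) : Rule Δ NodeState NodeState := fun s r =>
  { s with
    out := s.out || (s.act && (r i).any fun q => q.2 == (j : ℕ) && q.1.act && !s.out && !q.1.inc)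
    inc := s.inc || (s.act && (r j).any fun q => q.2 == (i : ℕ) && q.1.act && !q.1.out && !s.inc) }

/-- The nodes with two matched copies enter the cover; those with one stay active. -/
def closeRule {Δ : ℕ} : Rule Δ NodeState NodeState := fun s _ =>
  { act := s.out ^^ s.inc
    out := false
    inc := false
    cov := s.cov || (s.out && s.inc) }

/-- Compute a maximal matching in the double cover of the graph of active nodes. -/
def matchRules (Δ : ℕ) : List (Rule Δ NodeState NodeState) :=
  (List.finRange Δ ×ˢ List.finRange Δ).map fun q => matchRule q.1 q.2

/-- The algorithm with `k` phases. -/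
def coverRules (Δ k : ℕ) : List (Rule Δ NodeState NodeState) :=
  (List.replicate k (matchRules Δ ++ [closeRule])).flatten

/-- A partial matching between the nodes has at most twice as many ends as ends in a given
vertex cover. -/
theorem sum_matched_le_two_mul {n : ℕ} {G : SimpleGraph (Fin n)} {C : Finset (Fin n)}
    (hC : G.IsVertexCover (C : Set (Fin n)))
    {D : Fin n → Fin n → Prop} (hadj : ∀ u v, D u v → G.Adj u v)
    (hright : ∀ u v w, D u v → D u w → v = w) (hleft : ∀ u v w, D u w → D v w → u = v)
    [∀ u v, Decidable (D u v)] :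
    ∑ v, ((if ∃ w, D v w then (1 : ℝ) else 0) + if ∃ w, D w v then 1 else 0)
      ≤ 2 * ∑ v ∈ C, ((if ∃ w, D v w then (1 : ℝ) else 0) + if ∃ w, D w v then 1 else 0) := by
  have hout : ∀ u, (if ∃ w, D u w then (1 : ℝ) else 0) = ∑ w, if D u w then 1 else 0 := fun u => by
    split_ifs with h
    · obtain ⟨w, hw⟩ := h
      rw [Fintype.sum_eq_single w fun w' hw' => if_neg fun h => hw' (hright _ _ _ h hw), if_pos hw]
    · push Not at h
      simp [h]
  have hinc : ∀ v, (if ∃ u, D u v then (1 : ℝ) else 0) = ∑ u, if D u v then 1 else 0 := fun v => by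
    split_ifs with h
    · obtain ⟨w, hw⟩ := h
      rw [Fintype.sum_eq_single w fun w' hw' => if_neg fun h => hw' (hleft _ _ _ h hw), if_pos hw]
    · push Not at h
      simp [h]
  simp only [hout, hinc, Finset.sum_add_distrib]
  have h₁ : ∑ v, ∑ u, (if D u v then (1 : ℝ) else 0) = ∑ u, ∑ v, if D u v then (1 : ℝ) else 0 :=
    Finset.sum_comm
  have h₂ : ∑ v ∈ C, ∑ w, (if D v w then (1 : ℝ) else 0)
      = ∑ u, ∑ v, if D u v ∧ u ∈ C then (1 : ℝ) else 0 := by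
    rw [← Finset.univ_inter C, ← Finset.filter_mem_eq_inter, Finset.sum_filter]
    refine Finset.sum_congr rfl fun u _ => ?_
    by_cases hu : u ∈ C <;> simp [hu]
  have h₃ : ∑ v ∈ C, ∑ u, (if D u v then (1 : ℝ) else 0)
      = ∑ u, ∑ v, if D u v ∧ v ∈ C then (1 : ℝ) else 0 := by
    rw [Finset.sum_comm]
    refine Finset.sum_congr rfl fun u _ => ?_
    rw [← Finset.univ_inter C, ← Finset.filter_mem_eq_inter, Finset.sum_filter]
    refine Finset.sum_congr rfl fun v _ => ?_
    by_cases hv : v ∈ C <;> simp [hv]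
  -- Both sums on the left count all arcs of `D`; it remains to see that each arc has at least one
  -- end in `C`.
  rw [h₁, h₂, h₃, ← two_mul]
  refine mul_le_mul_of_nonneg_left ?_ zero_le_two
  rw [← Finset.sum_add_distrib]
  refine Finset.sum_le_sum fun u _ => ?_
  rw [← Finset.sum_add_distrib]
  refine Finset.sum_le_sum fun v _ => ?_
  by_cases h : D u v
  · rcases hC (hadj u v h) with hu | hv
    · simp only [Finset.mem_coe] at hu
      by_cases hv : v ∈ C <;> simp [h, hu, hv]
    · simp only [Finset.mem_coe] at hv
      by_cases hu : u ∈ C <;> simp [h, hu, hv]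
  · simp [h]

/-! ### Invariant and edge packing of the cover algorithm -/

section Correctness

variable {n : ℕ} {G : SimpleGraph (Fin n)} [DecidableRel G.Adj] (P : ConsistentPortNumbering G)

/-- In the states `x` the edge from port `i` of `u` to port `j` of `v` can be matched. -/
def Matchable (i j : ℕ) (x : Fin n → NodeState) (u v : Fin n) : Prop :=
  P.Linked i j u v ∧ (x u).act = true ∧ (x v).act = true ∧ (x u).out = false ∧ (x v).inc = false

variable {P}

/-- Together with `matchRule_apply_inc` this shows that the two ends of an arc reach the same
decision independently: both flags record the same set of new arcs. -/
theorem matchRule_apply_out {Δ : ℕ} (i j : Fin Δ) (x : Fin n → NodeState) (u : Fin n) :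
    ((matchRule i j).apply P x u).out = true ↔ (x u).out = true ∨ ∃ v, Matchable P i j x u v := by
  have h : (∃ v, Matchable P i j x u v) ↔ ∃ t, received P Δ x u i = some (t, (j : ℕ)) ∧
      (x u).act = true ∧ t.act = true ∧ (x u).out = false ∧ t.inc = false := by
    simp only [P.received_eq_some_iff, Matchable]
    constructor
    · rintro ⟨v, hl, h⟩
      exact ⟨x v, ⟨v, hl, rfl⟩, h⟩
    · rintro ⟨_, ⟨v, hl, rfl⟩, h⟩
      exact ⟨v, hl, h⟩
  rw [h]
  rcases hr : received P Δ x u i with _ | ⟨t, m⟩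
  · simp [Rule.apply, matchRule, hr]
  · simp only [Rule.apply, matchRule, hr, Option.any_some, Option.some.injEq, Prod.mk.injEq,
      Bool.or_eq_true, Bool.and_eq_true, beq_iff_eq, Bool.not_eq_true', and_assoc]
    simp only [exists_eq_left']
    tauto

theorem matchRule_apply_inc {Δ : ℕ} (i j : Fin Δ) (x : Fin n → NodeState) (v : Fin n) :
    ((matchRule i j).apply P x v).inc = true ↔ (x v).inc = true ∨ ∃ u, Matchable P i j x u v := by
  have h : (∃ u, Matchable P i j x u v) ↔ ∃ t, received P Δ x v j = some (t, (i : ℕ)) ∧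
      (x v).act = true ∧ t.act = true ∧ (x v).inc = false ∧ t.out = false := by
    simp only [P.received_eq_some_iff, Matchable]
    constructor
    · rintro ⟨u, hl, h⟩
      exact ⟨x u, ⟨u, hl.symm, rfl⟩, by tauto⟩
    · rintro ⟨_, ⟨u, hl, rfl⟩, h⟩
      exact ⟨u, hl.symm, by tauto⟩
  rw [h]
  rcases hr : received P Δ x v j with _ | ⟨t, m⟩
  · simp [Rule.apply, matchRule, hr]
  · simp only [Rule.apply, matchRule, hr, Option.any_some, Option.some.injEq, Prod.mk.injEq,
      Bool.or_eq_true, Bool.and_eq_true, beq_iff_eq, Bool.not_eq_true', and_assoc]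
    simp only [exists_eq_left']
    tauto

/-- The numerical value of a Boolean. -/
def bit (b : Bool) : ℝ := if b = true then 1 else 0

@[simp]
theorem bit_true : bit true = 1 := rfl

@[simp]
theorem bit_false : bit false = 0 := rfl

/-- The loads that the nodes receive in phase `k` from the edge packing whose weights are halved
after each phase: they are at most `1`, they equal `1` at the nodes of the cover, and their sum is
at most twice the sum over any given vertex cover `C`. -/
structure IsLoad (C : Finset (Fin n)) (k : ℕ) (x : Fin n → NodeState) (y : Fin n → ℝ) : Prop where
  nonneg : ∀ v, 0 ≤ y v
  le_one : ∀ v, y v ≤ 1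
  cov : ∀ v, (x v).cov = true → y v = 1
  act : ∀ v, (x v).act = true →
    y v = 1 - (1 / 2) ^ k + (1 / 2) ^ (k + 1) * (bit (x v).out + bit (x v).inc)
  sum_le : ∑ v, y v ≤ 2 * ∑ v ∈ C, y v

/-- The invariant of the algorithm in phase `k`. -/
structure CoverInvariant (G : SimpleGraph (Fin n)) [DecidableRel G.Adj] (Δ : ℕ)
    (C : Finset (Fin n)) (k : ℕ) (x : Fin n → NodeState) : Prop where
  not_cov : ∀ v, (x v).act = true → (x v).cov = false
  act_of_out : ∀ v, (x v).out = true → (x v).act = true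
  act_of_inc : ∀ v, (x v).inc = true → (x v).act = true
  exists_inc : ∀ v, (x v).out = true → ∃ w, G.Adj v w ∧ (x w).inc = true
  exists_out : ∀ v, (x v).inc = true → ∃ w, G.Adj v w ∧ (x w).out = true
  edge : ∀ u v, G.Adj u v →
    (x u).cov = true ∨ (x v).cov = true ∨ (x u).act = true ∧ (x v).act = true
  degree : ∀ u, (x u).act = true →
    ((G.neighborFinset u).filter fun w => (x w).act = true).card + k ≤ Δ
  load : ∃ y, IsLoad C k x y

variable {Δ : ℕ} {C : Finset (Fin n)} {k : ℕ} {x : Fin n → NodeState}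

theorem coverInvariant_init (hG : HasMaxDegreeAtMost G Δ) :
    CoverInvariant G Δ C 0 fun _ => ⟨true, false, false, false⟩ where
  not_cov := by simp
  act_of_out := by simp
  act_of_inc := by simp
  exists_inc := by simp
  exists_out := by simp
  edge := by simp
  degree u _ := by simpa using hG u
  load := ⟨fun _ => 0, by constructor <;> simp [bit]⟩

/-- Every new arc adds 2^-(k+1) to the load of both ends; `c v` is the number of new arcs at `v`. A
newly matched copy was free before, so the flags grow by exactly `c v`. -/
theorem IsLoad.matchRule (hC : G.IsVertexCover (C : Set (Fin n)))
    (hx : CoverInvariant G Δ C k x) {y : Fin n → ℝ} (hy : IsLoad C k x y) (i j : Fin Δ) :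
    ∃ y', IsLoad C k ((matchRule i j).apply P x) y' := by
  classical
  let c : Fin n → ℝ := fun v => (if ∃ w, Matchable P i j x v w then (1 : ℝ) else 0) +
    if ∃ w, Matchable P i j x w v then 1 else 0
  have hhalf : (0 : ℝ) < (1 / 2) ^ (k + 1) := by positivity
  have hc0 : ∀ v, 0 ≤ c v := fun v => by
    simp only [c]
    split_ifs <;> norm_num
  have hc : ∀ v, (x v).act = false → c v = 0 := fun v hv => by
    simp [c, Matchable, hv]
  have hact : ∀ v, (x v).act = true → y v + (1 / 2) ^ (k + 1) * c v
      = 1 - (1 / 2) ^ k + (1 / 2) ^ (k + 1) *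
        (bit ((_root_.matchRule i j).apply P x v).out
          + bit ((_root_.matchRule i j).apply P x v).inc) := fun v hv => by
    rw [hy.act v hv]
    have hout : bit ((_root_.matchRule i j).apply P x v).out
        = bit (x v).out + if ∃ w, Matchable P i j x v w then (1 : ℝ) else 0 := by
      simp only [bit, matchRule_apply_out]
      by_cases h : ∃ w, Matchable P i j x v w
      · have : (x v).out = false := h.elim fun w h => h.2.2.2.1
        simp [h, this]
      · simp [h]
    have hinc : bit ((_root_.matchRule i j).apply P x v).inc
        = bit (x v).inc + if ∃ w, Matchable P i j x w v then (1 : ℝ) else 0 := by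
      simp only [bit, matchRule_apply_inc]
      by_cases h : ∃ w, Matchable P i j x w v
      · have : (x v).inc = false := h.elim fun w h => h.2.2.2.2
        simp [h, this]
      · simp [h]
    rw [hout, hinc]
    ring
  refine ⟨fun v => y v + (1 / 2) ^ (k + 1) * c v, ?_, ?_, ?_, hact, ?_⟩
  · exact fun v => add_nonneg (hy.nonneg v) (mul_nonneg hhalf.le (hc0 v))
  · intro v
    rcases hv : (x v).act with _ | _
    · simpa [hc v hv] using hy.le_one v
    · have hb : ∀ b, bit b ≤ 1 := fun b => by cases b <;> simp [bit]
      have h₁ := hb ((_root_.matchRule i j).apply P x v).out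
      have h₂ := hb ((_root_.matchRule i j).apply P x v).inc
      have h₃ : (1 / 2 : ℝ) ^ k = (1 / 2) ^ (k + 1) * 2 := by rw [pow_succ]; ring
      change y v + (1 / 2) ^ (k + 1) * c v ≤ 1
      rw [hact v hv, h₃]
      nlinarith
  · intro v hv
    change (x v).cov = true at hv
    -- Nodes of the cover are no longer active, so they gain no arc and keep load 1.
    have : (x v).act = false := by
      by_contra h
      simp [hx.not_cov v (by simpa using h)] at hv
    simp [hc v this, hy.cov v hv]
  · rw [Finset.sum_add_distrib, Finset.sum_add_distrib, ← Finset.mul_sum, ← Finset.mul_sum]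
    have := sum_matched_le_two_mul hC (D := Matchable P i j x) (fun u v h => h.1.adj)
      (fun u v w h h' => h.1.right_unique h'.1) (fun u v w h h' => h.1.left_unique h'.1)
    have := mul_le_mul_of_nonneg_left this hhalf.le
    linarith [hy.sum_le]

theorem CoverInvariant.matchRule (hC : G.IsVertexCover (C : Set (Fin n)))
    (hx : CoverInvariant G Δ C k x) (i j : Fin Δ) :
    CoverInvariant G Δ C k ((matchRule i j).apply P x) where
  not_cov := hx.not_cov
  act_of_out v h := by
    rcases (matchRule_apply_out i j x v).1 h with h | ⟨w, h⟩
    exacts [hx.act_of_out v h, h.2.1]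
  act_of_inc v h := by
    rcases (matchRule_apply_inc i j x v).1 h with h | ⟨w, h⟩
    exacts [hx.act_of_inc v h, h.2.2.1]
  exists_inc v h := by
    simp only [matchRule_apply_inc]
    rcases (matchRule_apply_out i j x v).1 h with h | ⟨w, h⟩
    · obtain ⟨w, hw, h⟩ := hx.exists_inc v h
      exact ⟨w, hw, .inl h⟩
    · exact ⟨w, h.1.adj, .inr ⟨v, h⟩⟩
  exists_out v h := by
    simp only [matchRule_apply_out]
    rcases (matchRule_apply_inc i j x v).1 h with h | ⟨w, h⟩
    · obtain ⟨w, hw, h⟩ := hx.exists_out v h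
      exact ⟨w, hw, .inl h⟩
    · exact ⟨w, h.1.adj.symm, .inr ⟨v, h⟩⟩
  edge := hx.edge
  degree := hx.degree
  load := hx.load.elim fun _ hy => hy.matchRule hC hx i j

/-- After a list of matching rounds the invariant holds, no active node is lost, and the treated
edges have a matched end. -/
theorem CoverInvariant.applyRules_map_matchRule (hC : G.IsVertexCover (C : Set (Fin n)))
    (hx : CoverInvariant G Δ C k x) (l : List (Fin Δ × Fin Δ)) :
    CoverInvariant G Δ C k (applyRules P (l.map fun q => _root_.matchRule q.1 q.2) x) ∧
    (∀ v, (applyRules P (l.map fun q => _root_.matchRule q.1 q.2) x v).act = (x v).act) ∧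
    (∀ v, (x v).out = true →
      (applyRules P (l.map fun q => _root_.matchRule q.1 q.2) x v).out = true) ∧
    (∀ v, (x v).inc = true →
      (applyRules P (l.map fun q => _root_.matchRule q.1 q.2) x v).inc = true) ∧
    ∀ q ∈ l, ∀ u v, P.Linked q.1 q.2 u v → (x u).act = true → (x v).act = true →
      (applyRules P (l.map fun q => _root_.matchRule q.1 q.2) x u).out = true ∨
      (applyRules P (l.map fun q => _root_.matchRule q.1 q.2) x v).inc = true := by
  induction l generalizing x with
  | nil => exact ⟨hx, fun _ => rfl, fun _ h => h, fun _ h => h, by simp⟩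
  | cons q l ih =>
    obtain ⟨h₁, h₂, h₃, h₄, h₅⟩ := ih (hx.matchRule (P := P) hC q.1 q.2)
    have hout := matchRule_apply_out (P := P) q.1 q.2 x
    have hinc := matchRule_apply_inc (P := P) q.1 q.2 x
    refine ⟨h₁, h₂, fun v h => h₃ v ((hout v).2 (.inl h)), fun v h => h₄ v ((hinc v).2 (.inl h)),
      fun q' hq u v hl hu hv => ?_⟩
    -- When its pair is treated, an arc either has a matched end copy already or is matched now;
    -- matched copies stay matched.
    rcases List.mem_cons.1 hq with rfl | hq
    · rcases h : (x u).out with _ | _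
      · rcases h' : (x v).inc with _ | _
        · exact .inl (h₃ u ((hout u).2 (.inr ⟨v, hl, hu, hv, h, h'⟩)))
        · exact .inr (h₄ v ((hinc v).2 (.inl h')))
      · exact .inl (h₃ u ((hout u).2 (.inl h)))
    · exact h₅ q' hq u v hl hu hv

/-- The load does not change. One matched copy gives 1 - 2^-k + 2^-(k+1) = 1 - 2^-(k+1), the value
required of an active node at the start of the next phase. -/
theorem IsLoad.closeRule (hx : CoverInvariant G Δ C k x) {y : Fin n → ℝ} (hy : IsLoad C k x y) :
    IsLoad C (k + 1) ((closeRule (Δ := Δ)).apply P x) y where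
  nonneg := hy.nonneg
  le_one := hy.le_one
  cov v h := by
    simp only [Rule.apply, _root_.closeRule, Bool.or_eq_true, Bool.and_eq_true] at h
    rcases h with h | ⟨h₁, h₂⟩
    · exact hy.cov v h
    · rw [hy.act v (hx.act_of_out v h₁), h₁, h₂, pow_succ]
      simp only [bit_true]
      ring
  act v h := by
    simp only [Rule.apply, _root_.closeRule] at h ⊢
    rcases h₁ : (x v).out with _ | _ <;> rcases h₂ : (x v).inc with _ | _ <;> simp [h₁, h₂] at h
    · rw [hy.act v (hx.act_of_inc v h₂), h₁, h₂, pow_succ]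
      simp only [bit_true, bit_false]
      ring
    · rw [hy.act v (hx.act_of_out v h₁), h₁, h₂, pow_succ]
      simp only [bit_true, bit_false]
      ring
  sum_le := hy.sum_le

theorem CoverInvariant.closeRule (hx : CoverInvariant G Δ C k x)
    (hmax : ∀ u v, G.Adj u v → (x u).act = true → (x v).act = true →
      (x u).out = true ∨ (x v).inc = true) :
    CoverInvariant G Δ C (k + 1) ((closeRule (Δ := Δ)).apply P x) where
  not_cov v h := by
    simp only [Rule.apply, _root_.closeRule] at h ⊢
    rcases h₁ : (x v).out with _ | _ <;> rcases h₂ : (x v).inc with _ | _ <;> simp [h₁, h₂] at h ⊢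
    · exact hx.not_cov v (hx.act_of_inc v h₂)
    · exact hx.not_cov v (hx.act_of_out v h₁)
  act_of_out v h := by simp [Rule.apply, _root_.closeRule] at h
  act_of_inc v h := by simp [Rule.apply, _root_.closeRule] at h
  exists_inc v h := by simp [Rule.apply, _root_.closeRule] at h
  exists_out v h := by simp [Rule.apply, _root_.closeRule] at h
  edge u v huv := by
    simp only [Rule.apply, _root_.closeRule]
    rcases hx.edge u v huv with h | h | ⟨hu, hv⟩
    · simp [h]
    · simp [h]
    -- Maximality is used for both arcs of the edge: if one end has no matched copy, then the other
    -- has two.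
    · have h₁ := hmax u v huv hu hv
      have h₂ := hmax v u huv.symm hv hu
      revert h₁ h₂
      cases (x u).out <;> cases (x u).inc <;> cases (x v).out <;> cases (x v).inc <;> simp
  degree u hu := by
    have hact : ∀ v, ((_root_.closeRule (Δ := Δ)).apply P x v).act = true → (x v).act = true :=
      fun v h => by
        simp only [Rule.apply, _root_.closeRule] at h
        rcases h₁ : (x v).out with _ | _
        · exact hx.act_of_inc v (by simpa [h₁] using h)
        · exact hx.act_of_out v h₁
    -- Exactly one copy of `u` is matched; `w` is a neighbour matched on the opposite side. As the
    -- other copy of `u` is free, maximality for the reverse arc matches the other copy of `w` too,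
    -- so `w` leaves the active set.
    obtain ⟨w, hw, hwact, hw'⟩ : ∃ w, G.Adj u w ∧ (x w).act = true ∧
        ((_root_.closeRule (Δ := Δ)).apply P x w).act = false := by
      have hu' := hact u hu
      simp only [Rule.apply, _root_.closeRule] at hu ⊢
      rcases h₁ : (x u).out with _ | _
      · have h₂ : (x u).inc = true := by simpa [h₁] using hu
        obtain ⟨w, hw, hwo⟩ := hx.exists_out u h₂
        have hwa := hx.act_of_out w hwo
        have := hmax u w hw hu' hwa
        exact ⟨w, hw, hwa, by simp_all⟩
      · have h₂ : (x u).inc = false := by simpa [h₁] using hu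
        obtain ⟨w, hw, hwi⟩ := hx.exists_inc u h₁
        have hwa := hx.act_of_inc w hwi
        have := hmax w u hw.symm hwa hu'
        exact ⟨w, hw, hwa, by simp_all⟩
    have hlt : ((G.neighborFinset u).filter fun w =>
        ((_root_.closeRule (Δ := Δ)).apply P x w).act = true).card
        < ((G.neighborFinset u).filter fun w => (x w).act = true).card := by
      refine Finset.card_lt_card ⟨fun v hv => ?_, fun h => ?_⟩
      · rw [Finset.mem_filter] at hv ⊢
        exact ⟨hv.1, hact v hv.2⟩
      · have := h (Finset.mem_filter.2 ⟨(G.mem_neighborFinset u w).2 hw, hwact⟩)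
        rw [Finset.mem_filter, hw'] at this
        simp at this
    have := hx.degree u (hact u hu)
    omega
  load := hx.load.elim fun y hy => ⟨y, hy.closeRule hx⟩

theorem CoverInvariant.applyRules_coverRules (hG : HasMaxDegreeAtMost G Δ)
    (hC : G.IsVertexCover (C : Set (Fin n))) (hx : CoverInvariant G Δ C k x) (m : ℕ) :
    CoverInvariant G Δ C (k + m) (applyRules P (coverRules Δ m) x) := by
  induction m generalizing k x with
  | zero => exact hx
  | succ m ih =>
    obtain ⟨h₁, h₂, -, -, h₃⟩ := hx.applyRules_map_matchRule (P := P) hC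
      (List.finRange Δ ×ˢ List.finRange Δ)
    have h := ih (h₁.closeRule (P := P) fun u v huv hu hv => by
      obtain ⟨i, j, hij⟩ := P.exists_linked hG huv
      exact h₃ (i, j) (by simp) u v hij (h₂ u ▸ hu) (h₂ v ▸ hv))
    rw [Nat.add_right_comm, Nat.add_assoc] at h
    simpa [coverRules, List.replicate_succ, applyRules, matchRules, List.foldl_append] using h

/-- After Δ phases the degree bound leaves an active node no active neighbour, which excludes the
only uncovered kind of edge. -/
theorem CoverInvariant.isVertexCover (hx : CoverInvariant G Δ C Δ x) :
    G.IsVertexCover {v | (x v).cov = true} := by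
  intro u v huv
  rcases hx.edge u v huv with h | h | ⟨hu, hv⟩
  · exact .inl h
  · exact .inr h
  · have hpos := Finset.card_pos.2
      ⟨v, Finset.mem_filter (p := fun w => (x w).act = true).2 ⟨(G.mem_neighborFinset u v).2 huv, hv⟩⟩
    have := hx.degree u hu
    omega

theorem CoverInvariant.ncard_le (hx : CoverInvariant G Δ C k x) :
    ({v | (x v).cov = true}.ncard : ℝ) ≤ 2 * C.card := by
  obtain ⟨y, hy⟩ := hx.load
  have hset : {v | (x v).cov = true}
      = ((Finset.univ.filter fun v => (x v).cov = true : Finset (Fin n)) : Set (Fin n)) := by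
    simp
  rw [hset, Set.ncard_coe_finset]
  calc ((Finset.univ.filter fun v => (x v).cov = true).card : ℝ)
      = ∑ v ∈ Finset.univ.filter fun v => (x v).cov = true, y v := by
        rw [Finset.sum_congr rfl fun v hv => hy.cov v (Finset.mem_filter.1 hv).2]
        simp
    _ ≤ ∑ v, y v := Finset.sum_le_univ_sum_of_nonneg hy.nonneg
    _ ≤ 2 * ∑ v ∈ C, y v := hy.sum_le
    _ ≤ 2 * C.card := by
        have := Finset.sum_le_sum fun v (_ : v ∈ C) => hy.le_one v
        simp only [Finset.sum_const, nsmul_eq_mul, mul_one] at this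
        linarith

end Correctness

theorem cpngnnsSolve_two_approxMinVertexCover : CPNGNNsSolve (approxMinVertexCover 2) := by
  intro Δ _
  obtain ⟨N, hN⟩ := exists_cpngnn_applyRules (⟨true, false, false, false⟩ : NodeState)
    (coverRules Δ Δ) NodeState.cov
  refine ⟨N, fun n G _ hG P => ?_⟩
  -- The minimum cover enters only the analysis; the rules do not depend on it.
  obtain ⟨s, hs, hcov⟩ := G.vertexCoverNum_exists
  obtain ⟨C, rfl⟩ := s.toFinite.exists_finset_coe
  have hinv := (coverInvariant_init (C := C) hG).applyRules_coverRules (P := P) hG hcov Δ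
  rw [zero_add] at hinv
  have hrun : {v | N.run G P v = 1} = {v | (applyRules P (coverRules Δ Δ)
      (fun _ => (⟨true, false, false, false⟩ : NodeState)) v).cov = true} :=
    Set.ext fun v => hN n G hG P v
  have hnum : G.vertexCoverNum.toNat = C.card := by
    rw [← hs, Set.encard_coe_eq_coe_finsetCard]
    rfl
  refine ⟨?_, ?_⟩
  · rw [hrun]
    exact hinv.isVertexCover
  · rw [hrun, hnum]
    exact hinv.ncard_le

/-! # The lower bound -/

/-- If all nodes have the same embedding and see the same port numbers, then this stays so. -/
theorem Layers.eval_eq_of_symmetric {n : ℕ} {G : SimpleGraph (Fin n)} [DecidableRel G.Adj]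
    (P : ConsistentPortNumbering G) {Δ : ℕ} (hP : ∀ u v i, P.number u i = P.number v i)
    {d e : ℕ} (L : Layers Δ d e) (z : Fin n → Fin d → ℝ) (hz : ∀ u v, z u = z v) (u v : Fin n) :
    L.eval P z u = L.eval P z v := by
  induction L with
  | nil d => exact hz u v
  | cons W rest ih =>
    refine ih _ fun u v => ?_
    have hc : concat P Δ z u = concat P Δ z v := by
      funext k
      rcases k with k | ⟨i, k | _⟩
      · exact congrFun (hz u v) k
      · have h := hP u v i
        simp only [concat, ConsistentPortNumbering.tail, ConsistentPortNumbering.number] at h ⊢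
        -- Equal numbers mean that both ports exist or both are missing; in the first case the
        -- senders' embeddings agree by `hz`.
        cases hu : P.source u i <;> cases hv : P.source v i <;> simp [hu, hv] at h ⊢
        exact congrFun (hz _ _) k
      · simp only [concat, hP u v]
    rw [hc]

theorem degree_top_fin_two (v : Fin 2) : (⊤ : SimpleGraph (Fin 2)).degree v = 1 := by
  simp

/-- The port numbering of the graph with two nodes and one edge. -/
def edgePortNumbering : ConsistentPortNumbering (⊤ : SimpleGraph (Fin 2)) where
  -- Adding 1 in `Fin 2` swaps the nodes, and 0 is the only port index.
  p q := ⟨q.1 + 1, ⟨0, by simp⟩⟩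
  edge u v h := ⟨⟨0, by simp⟩, ⟨0, by simp⟩, by
    have : v = u + 1 := by revert u v; decide
    subst this; rfl⟩
  involutive := by
    rintro ⟨v, i⟩
    have h : v + 1 + 1 = v := by revert v; decide
    have hi : (i : ℕ) = 0 := by have := i.2; simp only [degree_top_fin_two] at this; omega
    refine Sigma.ext h ?_
    rw [Fin.heq_ext_iff (by simp)]
    exact hi.symm

theorem not_cpngnnsSolve_approxMinVertexCover {α : ℝ} (hα : α < 2) :
    ¬ CPNGNNsSolve (approxMinVertexCover α) := by
  intro h
  obtain ⟨N, hN⟩ := h 1 one_pos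
  obtain ⟨hcov, hcard⟩ := hN 2 ⊤ (fun v => by simp) edgePortNumbering
  have hsym : N.run ⊤ edgePortNumbering 0 = N.run ⊤ edgePortNumbering 1 := by
    unfold CPNGNN.run
    rw [Layers.eval_eq_of_symmetric edgePortNumbering (fun u v i => ?_) N.layers _ (fun u v => ?_)]
    · simp only [ConsistentPortNumbering.number, ConsistentPortNumbering.source,
        degree_top_fin_two]
      split_ifs <;> rfl
    · funext k
      simp [degreeFeature]
  have hall : {v | N.run ⊤ edgePortNumbering v = 1} = Set.univ := by
    -- The edge forces one node into the cover, and symmetry then forces the other.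
    have h01 := hcov (show (⊤ : SimpleGraph (Fin 2)).Adj 0 1 by simp)
    ext v
    simp only [Set.mem_ofPred_eq, Set.mem_univ, iff_true] at h01 ⊢
    fin_cases v
    · simpa [hsym] using h01
    · simpa [hsym] using h01
  have hτ : (⊤ : SimpleGraph (Fin 2)).vertexCoverNum.toNat = 1 := by
    rw [SimpleGraph.vertexCoverNum_top, ENat.card_eq_coe_fintype_card, Fintype.card_fin]
    rfl
  rw [hall, hτ, Set.ncard_univ, Nat.card_eq_fintype_card, Fintype.card_fin] at hcard
  norm_num at hcard
  linarith

theorem theorem7 :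
    CPNGNNsSolve (approxMinVertexCover 2) ∧
      ∀ α : ℝ, 1 ≤ α → α < 2 → ¬ CPNGNNsSolve (approxMinVertexCover α) :=
  ⟨cpngnnsSolve_two_approxMinVertexCover,
    fun _ _ hα => not_cpngnnsSolve_approxMinVertexCover hα⟩
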